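/- Let $n_0\ge 1$ be an integer and let $\mu$ be a positive Radon measure on $[0,\infty)$ such that $\int_0^\infty n_0^{-2\sigma}\,d\mu(\sigma)<\infty$ and $0$ belongs to the support of $\mu$. For $n\ge n_0$ put $$w_n=\int_0^\infty n^{-2\sigma}\,d\mu(\sigma).$$ Let $f(s)=\sum_{n=n_0}^\infty a_n n^{-s}$ be a Dirichlet series with complex coefficients whose abscissa of boundedness $$\sigma_b=\inf\Big\{\rho\in\mathbb R:\ \sum_{n=n_0}^\infty a_n n^{-s}\text{ converges to a bounded function in } \{\operatorname{Re}s>\rho\}\Big\}$$ equals $0$. Then, for every $c>0$, the limit as $T\to\infty$ below exists in $[0,\infty]$, the limit as $c\to0^+$ of these exists in $[0,\infty]$, and $$\sum_{n=n_0}^\infty |a_n|^2 w_n=\lim_{c\to0^+}\ \lim_{T\to\infty}\ \frac1{2T}\int_{-T}^{T}dt\int_0^\infty |f(\sigma+it+c)|^2\,d\mu(\sigma),$$ where both sides may equal $+\infty$. -/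

import Mathlib

open MeasureTheory Filter Topology
open scoped NNReal ENNReal

/-- The partial sum `∑_{n=1}^N a_n n^{-s}` of a Dirichlet series. -/
noncomputable def dirichletPartialSum (a : ℕ → ℂ) (N : ℕ) (s : ℂ) : ℂ :=
  ∑ n ∈ Finset.Icc 1 N, a n * (n : ℂ) ^ (-s)

/-- The Dirichlet series `∑ a_n n^{-s}` converges (possibly only conditionally) at `s`. -/
def DirichletConvergesAt (a : ℕ → ℂ) (s : ℂ) : Prop :=
  ∃ l : ℂ, Tendsto (fun N : ℕ => dirichletPartialSum a N s) atTop (𝓝 l)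

/-- The sum `∑ a_n n^{-s}`, as the limit of the partial sums; only meaningful at points
where the series converges. -/
noncomputable def dirichletSum (a : ℕ → ℂ) (s : ℂ) : ℂ :=
  limUnder atTop (fun N : ℕ => dirichletPartialSum a N s)

/-- The series converges to a bounded function in the open half-plane `Re s > ρ`. -/
def DirichletBoundedOn (a : ℕ → ℂ) (ρ : ℝ) : Prop :=
  (∀ s : ℂ, ρ < s.re → DirichletConvergesAt a s) ∧
    ∃ C : ℝ, ∀ s : ℂ, ρ < s.re → ‖dirichletSum a s‖ ≤ C

/-- The abscissa of boundedness `σ_b`, an extended real number. -/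
noncomputable def abscissaOfBoundedness (a : ℕ → ℂ) : EReal :=
  sInf ((fun ρ : ℝ => (ρ : EReal)) '' {ρ : ℝ | DirichletBoundedOn a ρ})

/-- The weight `w_n = ∫_0^∞ n^{-2σ} dμ(σ)`, with values in `[0, ∞]`. -/
noncomputable def dirichletWeight (μ : Measure ℝ≥0) (n : ℕ) : ℝ≥0∞ :=
  ∫⁻ σ : ℝ≥0, ENNReal.ofReal ((n : ℝ) ^ (-2 * (σ : ℝ))) ∂μ

/-- The mean `(1/2T) ∫_{-T}^T dt ∫_0^∞ |f(σ + it + c)|² dμ(σ)`, with values in `[0, ∞]`,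
where `f` is the sum of the Dirichlet series with coefficients `a`. -/
noncomputable def dirichletMean (μ : Measure ℝ≥0) (a : ℕ → ℂ) (c T : ℝ) : ℝ≥0∞ :=
  (ENNReal.ofReal (2 * T))⁻¹ *
    ∫⁻ t in Set.Icc (-T) T, ∫⁻ σ : ℝ≥0,
      ENNReal.ofReal
        (‖dirichletSum a (((σ : ℝ) : ℂ) + (t : ℂ) * Complex.I + (c : ℂ))‖ ^ 2) ∂μ

/-! Fix `c > 0`. Since the abscissa of boundedness is `0`, `f` is bounded on `Re s > ρ` for some `ρ
< c`. Carlson's theorem then says that the mean of `|f(σ + c + it)|²` over `[-T, T]` tends to `∑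
|a_n|² n^{-2(σ+c)}` for every `σ ≥ 0`. Tonelli and dominated convergence integrate this against `μ`:
since the series starts at `n₀`, `f` is `O(n₀^{-Re s})`, and the majorant `n₀^{-2σ}` is
`μ`-integrable by hypothesis. The inner limit is therefore `∑ |a_n|² n^{-2c} w_n`, which increases
to `∑ |a_n|² w_n` as `c` decreases to `0` (`tendsto_dirichletMean`, `tendsto_tsum_rpow_mul`).

The core is Carlson's theorem, `tendsto_mean_norm_sq_dirichletSum`. The series may converge only
conditionally, so Parseval does not apply to it directly. Averaging `f` along vertical lines against
a Gaussian of scale `h` multiplies `a_n` by `exp(-(h log n)²/2)`. The new coefficients decay faster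
than every power of `n`, so the smoothed series converges absolutely and Parseval is elementary
(`tendsto_mean_norm_sq_tsum`). By Cauchy's estimate the smoothing moves `f` by only `O(h)`,
uniformly on smaller half-planes, and this allows the limits `h → 0` and `T → ∞` to be interchanged.
-/

open ProbabilityTheory

/-! ### Summation by parts and holomorphy of the sum -/

/-- Consecutive values of `n ↦ n^{-w}` differ by at most `‖w‖ n^{-Re w - 1}`. -/
lemma norm_natCast_cpow_sub_le (n : ℕ) {w : ℂ} (hw : 0 ≤ w.re) :
    ‖((n + 1 : ℕ) : ℂ) ^ (-w) - ((n + 2 : ℕ) : ℂ) ^ (-w)‖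
      ≤ ‖w‖ * ((n + 1 : ℕ) : ℝ) ^ (-w.re - 1) := by
  have hn : (0 : ℝ) < ((n + 1 : ℕ) : ℝ) := by positivity
  rcases eq_or_ne w 0 with rfl | hw0
  · simp
  have hd : ∀ x ∈ Set.Icc ((n + 1 : ℕ) : ℝ) ((n + 2 : ℕ) : ℝ),
      HasDerivWithinAt (fun y : ℝ => (y : ℂ) ^ (-w)) (-w * (x : ℂ) ^ (-w - 1))
        (Set.Icc ((n + 1 : ℕ) : ℝ) ((n + 2 : ℕ) : ℝ)) x := by
    intro x hx
    have hx0 : x ≠ 0 := (hn.trans_le hx.1).ne'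
    -- This is the derivative of `y^(r+1)/(r+1)` with `r + 1 = -w`; the division is why `w = 0` was
    -- treated apart.
    have := hasDerivAt_ofReal_cpow_const' (r := -w - 1) hx0 (by simpa using hw0)
    have h2 := this.const_mul (-w)
    refine HasDerivAt.hasDerivWithinAt ?_
    refine h2.congr_of_eventuallyEq (Eventually.of_forall fun y => ?_)
    have h3 : -w - 1 + 1 = -w := by ring
    have h4 : -w ≠ 0 := neg_ne_zero.2 hw0
    simp only [h3]
    rw [mul_div_cancel₀ _ h4]
  have hb : ∀ x ∈ Set.Icc ((n + 1 : ℕ) : ℝ) ((n + 2 : ℕ) : ℝ),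
      ‖-w * (x : ℂ) ^ (-w - 1)‖ ≤ ‖w‖ * ((n + 1 : ℕ) : ℝ) ^ (-w.re - 1) := by
    intro x hx
    have hx0 : 0 < x := hn.trans_le hx.1
    rw [norm_mul, norm_neg, Complex.norm_cpow_eq_rpow_re_of_pos hx0]
    refine mul_le_mul_of_nonneg_left ?_ (norm_nonneg _)
    simpa using Real.rpow_le_rpow_of_nonpos hn hx.1 (by linarith : -w.re - 1 ≤ 0)
  have h12 : ((n + 1 : ℕ) : ℝ) ≤ ((n + 2 : ℕ) : ℝ) := by push_cast; linarith
  have := (convex_Icc _ _).norm_image_sub_le_of_norm_hasDerivWithin_le hd hb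
    (Set.right_mem_Icc.2 h12) (Set.left_mem_Icc.2 h12)
  have h1 : ‖((n + 1 : ℕ) : ℝ) - ((n + 2 : ℕ) : ℝ)‖ = 1 := by
    push_cast; rw [show ((n : ℝ) + 1 - (n + 2)) = -1 by ring]; simp
  rw [h1, mul_one] at this
  simpa only [Complex.ofReal_natCast] using this

lemma dirichletPartialSum_eq_range (a : ℕ → ℂ) (N : ℕ) (s : ℂ) :
    dirichletPartialSum a N s = ∑ i ∈ Finset.range N, a (i + 1) * ((i + 1 : ℕ) : ℂ) ^ (-s) := by
  rw [dirichletPartialSum, Finset.range_eq_Ico,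
    Finset.sum_Ico_add' (fun n : ℕ => a n * (n : ℂ) ^ (-s)) 0 N 1]
  rfl

lemma dirichletPartialSum_succ (a : ℕ → ℂ) (N : ℕ) (s : ℂ) :
    dirichletPartialSum a (N + 1) s
      = dirichletPartialSum a N s + a (N + 1) * ((N + 1 : ℕ) : ℂ) ^ (-s) := by
  simp only [dirichletPartialSum_eq_range, Finset.sum_range_succ]

/-- Summation by parts for a Dirichlet series, relative to its partial sums at `s₀`. -/
lemma dirichletPartialSum_by_parts (a : ℕ → ℂ) (N : ℕ) (s₀ s : ℂ) :
    dirichletPartialSum a N s =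
      dirichletPartialSum a N s₀ * ((N + 1 : ℕ) : ℂ) ^ (-(s - s₀)) +
        ∑ i ∈ Finset.range N, dirichletPartialSum a (i + 1) s₀ *
          (((i + 1 : ℕ) : ℂ) ^ (-(s - s₀)) - ((i + 2 : ℕ) : ℂ) ^ (-(s - s₀))) := by
  induction N with
  | zero => simp [dirichletPartialSum]
  | succ N ih =>
    rw [dirichletPartialSum_succ, ih, Finset.sum_range_succ, dirichletPartialSum_succ a N s₀]
    have : ((N + 1 : ℕ) : ℂ) ^ (-s) = ((N + 1 : ℕ) : ℂ) ^ (-s₀) *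
        ((N + 1 : ℕ) : ℂ) ^ (-(s - s₀)) := by
      rw [← Complex.cpow_add _ _ (by exact_mod_cast N.succ_ne_zero)]; congr 1; ring
    rw [this]; ring

lemma DirichletConvergesAt.tendsto {a : ℕ → ℂ} {s : ℂ} (h : DirichletConvergesAt a s) :
    Tendsto (fun N : ℕ => dirichletPartialSum a N s) atTop (𝓝 (dirichletSum a s)) :=
  tendsto_nhds_limUnder h

lemma DirichletConvergesAt.exists_bound {a : ℕ → ℂ} {s : ℂ} (h : DirichletConvergesAt a s) :
    ∃ B : ℝ, 0 ≤ B ∧ ∀ N, ‖dirichletPartialSum a N s‖ ≤ B := by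
  obtain ⟨l, hl⟩ := h
  obtain ⟨B, hB⟩ := (Metric.isBounded_range_of_tendsto _ hl).exists_norm_le
  exact ⟨B, (norm_nonneg _).trans (hB _ ⟨0, rfl⟩), fun N => hB _ ⟨N, rfl⟩⟩

/-- A Dirichlet series convergent at `s₀` is, further right, an absolutely convergent series of
differences of powers. -/
lemma DirichletConvergesAt.dirichletSum_eq_tsum_by_parts {a : ℕ → ℂ} {s₀ s : ℂ}
    (h₀ : DirichletConvergesAt a s₀) (h : DirichletConvergesAt a s) (hs : s₀.re < s.re) :
    dirichletSum a s = ∑' i : ℕ, dirichletPartialSum a (i + 1) s₀ *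
          (((i + 1 : ℕ) : ℂ) ^ (-(s - s₀)) - ((i + 2 : ℕ) : ℂ) ^ (-(s - s₀))) := by
  obtain ⟨B, hB0, hB⟩ := h₀.exists_bound
  have hre : 0 < (s - s₀).re := by simpa using hs
  have hsum : Summable fun i : ℕ => dirichletPartialSum a (i + 1) s₀ *
      (((i + 1 : ℕ) : ℂ) ^ (-(s - s₀)) - ((i + 2 : ℕ) : ℂ) ^ (-(s - s₀))) := by
    refine Summable.of_norm_bounded
      (g := fun i : ℕ => B * (‖s - s₀‖ * ((i + 1 : ℕ) : ℝ) ^ (-(s - s₀).re - 1))) ?_ fun i => ?_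
    · refine ((Summable.mul_left _ ?_)).mul_left _
      exact (summable_nat_add_iff (f := fun n : ℕ => (n : ℝ) ^ (-(s - s₀).re - 1)) 1).2
        (Real.summable_nat_rpow.2 (by linarith))
    · rw [norm_mul]
      exact mul_le_mul (hB _) (norm_natCast_cpow_sub_le i hre.le) (norm_nonneg _) hB0
  -- The boundary term of the summation by parts vanishes in the limit, the partial sums at `s₀`
  -- being bounded.
  have hz : Tendsto (fun N : ℕ => dirichletPartialSum a N s₀ *
      ((N + 1 : ℕ) : ℂ) ^ (-(s - s₀))) atTop (𝓝 0) := by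
    have h1 : Tendsto (fun N : ℕ => B * ((N + 1 : ℕ) : ℝ) ^ (-(s - s₀).re)) atTop (𝓝 0) := by
      have := ((tendsto_rpow_neg_atTop hre).comp
        (tendsto_natCast_atTop_atTop.comp (tendsto_add_atTop_nat 1))).const_mul B
      simpa using this
    refine squeeze_zero_norm (fun N => ?_) h1
    rw [norm_mul, Complex.norm_natCast_cpow_of_pos N.succ_pos, Complex.neg_re]
    exact mul_le_mul_of_nonneg_right (hB N) (by positivity)
  have h2 := hz.add hsum.hasSum.tendsto_sum_nat
  rw [zero_add] at h2
  refine tendsto_nhds_unique h.tendsto (h2.congr fun N => ?_)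
  rw [dirichletPartialSum_by_parts a N s₀ s]

/-- The sum of a Dirichlet series is holomorphic in a half-plane of convergence. -/
lemma differentiableOn_dirichletSum {a : ℕ → ℂ} {ρ : ℝ}
    (h : ∀ s : ℂ, ρ < s.re → DirichletConvergesAt a s) :
    DifferentiableOn ℂ (dirichletSum a) {s : ℂ | ρ < s.re} := by
  intro z hz
  simp only [Set.mem_ofPred_eq] at hz
  -- `r` is the base point of the summation by parts. The gap `q - r > 0` makes the exponent `-(q -
  -- r) - 1 < -1` uniform near `z`.
  obtain ⟨r, hr1, hr2⟩ := exists_between hz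
  obtain ⟨q, hq1, hq2⟩ := exists_between hr2
  have h₀ : DirichletConvergesAt a (r : ℂ) := h _ (by simpa using hr1)
  obtain ⟨B, hB0, hB⟩ := h₀.exists_bound
  set U : Set ℂ := {s : ℂ | q < s.re} ∩ Metric.ball z 1 with hU
  have hUo : IsOpen U := (isOpen_lt continuous_const Complex.continuous_re).inter Metric.isOpen_ball
  have hD : DifferentiableOn ℂ (fun s : ℂ => ∑' i : ℕ, dirichletPartialSum a (i + 1) (r : ℂ) *
      (((i + 1 : ℕ) : ℂ) ^ (-(s - r)) - ((i + 2 : ℕ) : ℂ) ^ (-(s - r)))) U := by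
    refine Complex.differentiableOn_tsum_of_summable_norm
      (u := fun i : ℕ => B * ((‖z - r‖ + 1) * ((i + 1 : ℕ) : ℝ) ^ (-(q - r) - 1))) ?_ ?_ hUo ?_
    · refine ((Summable.mul_left _ ?_)).mul_left _
      exact (summable_nat_add_iff (f := fun n : ℕ => (n : ℝ) ^ (-(q - r) - 1)) 1).2
        (Real.summable_nat_rpow.2 (by linarith))
    · intro i
      refine Differentiable.differentiableOn ?_
      intro s
      have h1 : ((i + 1 : ℕ) : ℂ) ≠ 0 := by exact_mod_cast i.succ_ne_zero
      have h2 : ((i + 2 : ℕ) : ℂ) ≠ 0 := by exact_mod_cast (i + 1).succ_ne_zero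
      exact (((((differentiableAt_id).sub_const _).neg).const_cpow (Or.inl h1)).sub
        ((((differentiableAt_id).sub_const _).neg).const_cpow (Or.inl h2))).const_mul _
    · intro i s hs
      have hre : q - r < (s - r).re := by simpa using hs.1
      rw [norm_mul]
      refine mul_le_mul (hB _) ((norm_natCast_cpow_sub_le i (by linarith)).trans ?_)
        (norm_nonneg _) hB0
      refine mul_le_mul ?_ ?_ (by positivity) (by positivity)
      · have : ‖s - z‖ < 1 := by simpa [dist_eq_norm] using hs.2
        calc ‖s - r‖ = ‖(z - r) + (s - z)‖ := by congr 1; ring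
          _ ≤ ‖z - r‖ + ‖s - z‖ := norm_add_le _ _
          _ ≤ _ := by linarith
      · refine Real.rpow_le_rpow_of_exponent_le ?_ (by linarith)
        exact_mod_cast Nat.succ_pos i
  have hzU : U ∈ 𝓝 z := hUo.mem_nhds ⟨hq2, Metric.mem_ball_self one_pos⟩
  have hE : dirichletSum a =ᶠ[𝓝 z] fun s : ℂ => ∑' i : ℕ, dirichletPartialSum a (i + 1) (r : ℂ) *
      (((i + 1 : ℕ) : ℂ) ^ (-(s - r)) - ((i + 2 : ℕ) : ℂ) ^ (-(s - r))) := by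
    filter_upwards [hzU] with s hs
    have h3 : q < s.re := hs.1
    exact h₀.dirichletSum_eq_tsum_by_parts (h s (by linarith)) (by simpa using hq1.trans h3)
  exact ((hD.differentiableAt hzU).congr_of_eventuallyEq hE).differentiableWithinAt

/-! ### Coefficient bounds, absolute convergence and decay -/

/-- Convergence at a point bounds the coefficients. -/
lemma DirichletConvergesAt.exists_coeff_bound {a : ℕ → ℂ} {s₀ : ℂ}
    (h : DirichletConvergesAt a s₀) :
    ∃ B : ℝ, 0 ≤ B ∧ ∀ n : ℕ, 1 ≤ n → ‖a n‖ ≤ B * (n : ℝ) ^ s₀.re := by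
  obtain ⟨B, hB0, hB⟩ := h.exists_bound
  refine ⟨2 * B, by positivity, fun n hn => ?_⟩
  obtain ⟨k, rfl⟩ : ∃ k, n = k + 1 := ⟨n - 1, by omega⟩
  have h1 : ‖a (k + 1) * ((k + 1 : ℕ) : ℂ) ^ (-s₀)‖ ≤ 2 * B := by
    have : a (k + 1) * ((k + 1 : ℕ) : ℂ) ^ (-s₀) =
        dirichletPartialSum a (k + 1) s₀ - dirichletPartialSum a k s₀ := by
      rw [dirichletPartialSum_succ]; ring
    rw [this]
    refine (norm_sub_le _ _).trans ?_
    linarith [hB (k + 1), hB k]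
  rw [norm_mul, Complex.norm_natCast_cpow_of_pos hn, Complex.neg_re] at h1
  have hpos : (0 : ℝ) < ((k + 1 : ℕ) : ℝ) := by positivity
  calc ‖a (k + 1)‖ = ‖a (k + 1)‖ * ((k + 1 : ℕ) : ℝ) ^ (-s₀.re) * ((k + 1 : ℕ) : ℝ) ^ s₀.re := by
        rw [mul_assoc, ← Real.rpow_add hpos]; simp
    _ ≤ _ := mul_le_mul_of_nonneg_right h1 (by positivity)

/-- Absolute convergence one unit to the right of a point of convergence. -/
lemma DirichletConvergesAt.summable_norm {a : ℕ → ℂ} (ha : a 0 = 0) {s₀ : ℂ} {x : ℝ}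
    (h : DirichletConvergesAt a s₀) (hx : s₀.re + 1 < x) :
    Summable fun n : ℕ => ‖a n‖ * (n : ℝ) ^ (-x) := by
  obtain ⟨B, hB0, hB⟩ := h.exists_coeff_bound
  refine Summable.of_nonneg_of_le (fun n => by positivity) (fun n => ?_)
    ((Real.summable_nat_rpow.2 (by linarith : s₀.re - x < -1)).mul_left B)
  rcases Nat.eq_zero_or_pos n with rfl | hn
  · simp only [ha, norm_zero, zero_mul]; positivity
  · calc ‖a n‖ * (n : ℝ) ^ (-x) ≤ B * (n : ℝ) ^ s₀.re * (n : ℝ) ^ (-x) :=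
          mul_le_mul_of_nonneg_right (hB n hn) (by positivity)
      _ = _ := by
          rw [mul_assoc, ← Real.rpow_add (by exact_mod_cast hn)]; congr 2

lemma norm_coeff_mul_cpow {a : ℕ → ℂ} (ha : a 0 = 0) (n : ℕ) (s : ℂ) :
    ‖a n * (n : ℂ) ^ (-s)‖ = ‖a n‖ * (n : ℝ) ^ (-s.re) := by
  rcases Nat.eq_zero_or_pos n with rfl | hn
  · simp [ha]
  · rw [norm_mul, Complex.norm_natCast_cpow_of_pos hn, Complex.neg_re]

lemma dirichletSum_eq_tsum {a : ℕ → ℂ} (ha : a 0 = 0) {s : ℂ}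
    (h : Summable fun n : ℕ => ‖a n‖ * (n : ℝ) ^ (-s.re)) :
    dirichletSum a s = ∑' n : ℕ, a n * (n : ℂ) ^ (-s) := by
  have hs : Summable fun n : ℕ => a n * (n : ℂ) ^ (-s) :=
    Summable.of_norm (by simpa only [norm_coeff_mul_cpow ha] using h)
  have h1 : Tendsto (fun N : ℕ => dirichletPartialSum a N s) atTop
      (𝓝 (∑' n : ℕ, a n * (n : ℂ) ^ (-s))) := by
    refine (hs.hasSum.tendsto_sum_nat.comp (tendsto_add_atTop_nat 1)).congr fun N => ?_
    simp only [Function.comp]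
    rw [Finset.sum_range_succ', dirichletPartialSum_eq_range, ha, zero_mul, add_zero]
  exact h1.limUnder_eq

/-- A Dirichlet series starting at `n₀` and bounded in `Re s > ρ` is `O(n₀^{-Re s})` there. -/
lemma DirichletBoundedOn.exists_decay {a : ℕ → ℂ} {ρ : ℝ} (h : DirichletBoundedOn a ρ)
    {n₀ : ℕ} (hn₀ : 1 ≤ n₀) (ha : ∀ n < n₀, a n = 0) :
    ∃ C : ℝ, 0 ≤ C ∧ ∀ s : ℂ, ρ < s.re → ‖dirichletSum a s‖ ≤ C * (n₀ : ℝ) ^ (-s.re) := by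
  obtain ⟨hc, C₀, hC₀⟩ := h
  have ha0 : a 0 = 0 := ha 0 hn₀
  have hn1 : (1 : ℝ) ≤ n₀ := by exact_mod_cast hn₀
  have hn0 : (0 : ℝ) < n₀ := by linarith
  -- Convergence at `ρ + 1` gives absolute convergence at `ρ + 3`. For `Re s ≤ ρ + 3` the bound `C₀`
  -- suffices, as `n₀^(ρ+3-Re s) ≥ 1`; further right, each term with `n ≥ n₀` gains a factor at most
  -- `n₀^(ρ+3-Re s)`.
  have hsum : Summable fun n : ℕ => ‖a n‖ * (n : ℝ) ^ (-(ρ + 3)) :=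
    (hc ((ρ + 1 : ℝ) : ℂ) (by simp)).summable_norm ha0 (by simp; linarith)
  set S := ∑' n : ℕ, ‖a n‖ * (n : ℝ) ^ (-(ρ + 3))
  have hS : 0 ≤ S := tsum_nonneg fun n => by positivity
  have hC0 : 0 ≤ C₀ := (norm_nonneg _).trans (hC₀ ((ρ + 1 : ℝ) : ℂ) (by simp))
  refine ⟨(C₀ + S) * (n₀ : ℝ) ^ (ρ + 3), by positivity, fun s hs => ?_⟩
  rw [mul_assoc, ← Real.rpow_add hn0]
  rcases le_total s.re (ρ + 3) with h3 | h3
  · have : 1 ≤ (n₀ : ℝ) ^ (ρ + 3 + -s.re) := Real.one_le_rpow hn1 (by linarith)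
    calc _ ≤ C₀ := hC₀ s hs
      _ ≤ (C₀ + S) * 1 := by linarith
      _ ≤ _ := mul_le_mul_of_nonneg_left this (by positivity)
  · have hle : ∀ n : ℕ, ‖a n‖ * (n : ℝ) ^ (-s.re)
        ≤ ‖a n‖ * (n : ℝ) ^ (-(ρ + 3)) * (n₀ : ℝ) ^ (ρ + 3 + -s.re) := by
      intro n
      rcases lt_or_ge n n₀ with hn | hn
      · simp [ha n hn]
      · have hnn : (n₀ : ℝ) ≤ n := by exact_mod_cast hn
        have e : (n : ℝ) ^ (-s.re) = (n : ℝ) ^ (-(ρ + 3)) * (n : ℝ) ^ (ρ + 3 + -s.re) := by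
          rw [← Real.rpow_add (by linarith)]; congr 1; ring
        rw [e, mul_assoc]
        refine mul_le_mul_of_nonneg_left (mul_le_mul_of_nonneg_left ?_ (by positivity))
          (norm_nonneg _)
        exact Real.rpow_le_rpow_of_nonpos hn0 hnn (by linarith)
    have hs' : Summable fun n : ℕ => ‖a n‖ * (n : ℝ) ^ (-s.re) :=
      Summable.of_nonneg_of_le (fun n => by positivity) hle (hsum.mul_right _)
    rw [dirichletSum_eq_tsum ha0 hs']
    calc _ ≤ ∑' n : ℕ, ‖a n * (n : ℂ) ^ (-s)‖ :=
          norm_tsum_le_tsum_norm (by simpa only [norm_coeff_mul_cpow ha0] using hs')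
      _ = ∑' n : ℕ, ‖a n‖ * (n : ℝ) ^ (-s.re) := by simp only [norm_coeff_mul_cpow ha0]
      _ ≤ ∑' n : ℕ, ‖a n‖ * (n : ℝ) ^ (-(ρ + 3)) * (n₀ : ℝ) ^ (ρ + 3 + -s.re) :=
          hs'.tsum_le_tsum hle (hsum.mul_right _)
      _ = S * (n₀ : ℝ) ^ (ρ + 3 + -s.re) := tsum_mul_right
      _ ≤ _ := mul_le_mul_of_nonneg_right (by linarith) (by positivity)

/-! ### Gaussian smoothing on vertical lines -/

/-- Cauchy estimate: a bounded holomorphic function on a half-plane has bounded derivative on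
every smaller half-plane. -/
lemma exists_norm_deriv_le_of_bounded_halfPlane {g : ℂ → ℂ} {ρ κ C : ℝ}
    (hg : DifferentiableOn ℂ g {s : ℂ | ρ < s.re}) (hC : ∀ s : ℂ, ρ < s.re → ‖g s‖ ≤ C)
    (hκ : ρ < κ) : ∃ D : ℝ, 0 ≤ D ∧ ∀ s : ℂ, κ ≤ s.re → ‖deriv g s‖ ≤ D := by
  have hr : 0 < (κ - ρ) / 2 := by linarith
  have hC0 : 0 ≤ C := (norm_nonneg _).trans (hC ((ρ + 1 : ℝ) : ℂ) (by simp))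
  refine ⟨C / ((κ - ρ) / 2), by positivity, fun s hs => ?_⟩
  have hsub : ∀ z ∈ Metric.closedBall s ((κ - ρ) / 2), ρ < z.re := by
    intro z hz
    have h1 : ‖z - s‖ ≤ (κ - ρ) / 2 := by simpa [dist_eq_norm] using hz
    have h2 := (abs_le.1 ((Complex.abs_re_le_norm (z - s)).trans h1)).1
    rw [Complex.sub_re] at h2
    linarith
  refine Complex.norm_deriv_le_of_forall_mem_sphere_norm_le hr ?_
    fun z hz => hC z (hsub z (Metric.sphere_subset_closedBall hz))
  refine DifferentiableOn.diffContOnCl ?_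
  rw [closure_ball _ hr.ne']
  exact hg.mono hsub

lemma isOpen_halfPlane (ρ : ℝ) : IsOpen {s : ℂ | ρ < s.re} :=
  isOpen_lt continuous_const Complex.continuous_re

/-- The Gaussian average of `g` along the vertical line through `s`, at scale `h`. -/
noncomputable def gaussianSmoothing (g : ℂ → ℂ) (h : ℝ) (s : ℂ) : ℂ :=
  ∫ v : ℝ, g (s + ((h * v : ℝ) : ℂ) * Complex.I) ∂(gaussianReal 0 1)

lemma re_add_ofReal_mul_I (s : ℂ) (u : ℝ) : (s + (u : ℂ) * Complex.I).re = s.re := by simp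

lemma continuous_comp_vertical {g : ℂ → ℂ} {ρ : ℝ} (hg : ContinuousOn g {s : ℂ | ρ < s.re})
    {s : ℂ} (hs : ρ < s.re) (h : ℝ) :
    Continuous fun v : ℝ => g (s + ((h * v : ℝ) : ℂ) * Complex.I) :=
  hg.comp_continuous (by fun_prop) fun v => by
    simpa only [Set.mem_ofPred_eq, re_add_ofReal_mul_I] using hs

/-- Differentiation under the integral sign: near `z` the Cauchy estimate bounds the derivative by a
constant, which is integrable for a probability measure. -/
lemma differentiableOn_gaussianSmoothing {g : ℂ → ℂ} {ρ C : ℝ}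
    (hg : DifferentiableOn ℂ g {s : ℂ | ρ < s.re}) (hC : ∀ s : ℂ, ρ < s.re → ‖g s‖ ≤ C) (h : ℝ) :
    DifferentiableOn ℂ (gaussianSmoothing g h) {s : ℂ | ρ < s.re} := by
  intro z hz
  obtain ⟨κ, hκ1, hκ2⟩ := exists_between (show ρ < z.re from hz)
  obtain ⟨D, -, hD⟩ := exists_norm_deriv_le_of_bounded_halfPlane hg hC hκ1
  have hg' : ContinuousOn (deriv g) {s : ℂ | ρ < s.re} :=
    (hg.deriv (isOpen_halfPlane ρ)).continuousOn
  refine DifferentiableAt.differentiableWithinAt ?_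
  refine (hasDerivAt_integral_of_dominated_loc_of_deriv_le (μ := gaussianReal 0 1)
    (F := fun s (v : ℝ) => g (s + ((h * v : ℝ) : ℂ) * Complex.I))
    (F' := fun s (v : ℝ) => deriv g (s + ((h * v : ℝ) : ℂ) * Complex.I)) (bound := fun _ => D)
    ((isOpen_halfPlane κ).mem_nhds hκ2) ?_ ?_ ?_ ?_ (integrable_const _) ?_).2.differentiableAt
  · filter_upwards [(isOpen_halfPlane ρ).mem_nhds hz] with s hs
    exact (continuous_comp_vertical hg.continuousOn hs h).aestronglyMeasurable
  · refine Integrable.of_bound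
      (continuous_comp_vertical hg.continuousOn hz h).aestronglyMeasurable C
      (Eventually.of_forall fun v => hC _ ?_)
    rw [re_add_ofReal_mul_I]; exact hz
  · exact (continuous_comp_vertical hg' hz h).aestronglyMeasurable
  · refine Eventually.of_forall fun v s hs => hD _ ?_
    rw [re_add_ofReal_mul_I]; exact le_of_lt hs
  · refine Eventually.of_forall fun v s hs => ?_
    have h1 : s + ((h * v : ℝ) : ℂ) * Complex.I ∈ {s : ℂ | ρ < s.re} := by
      simpa only [Set.mem_ofPred_eq, re_add_ofReal_mul_I] using hκ1.trans hs
    exact HasDerivAt.comp_add_const _ _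
      (hg.differentiableAt ((isOpen_halfPlane ρ).mem_nhds h1)).hasDerivAt

/-- Gaussian smoothing at scale `h` moves a bounded holomorphic function by `O(h)`, uniformly in
smaller half-planes. -/
lemma exists_norm_gaussianSmoothing_sub_le {g : ℂ → ℂ} {ρ κ C : ℝ}
    (hg : DifferentiableOn ℂ g {s : ℂ | ρ < s.re}) (hC : ∀ s : ℂ, ρ < s.re → ‖g s‖ ≤ C)
    (hκ : ρ < κ) : ∃ D : ℝ, 0 ≤ D ∧ ∀ h : ℝ, 0 ≤ h → ∀ s : ℂ, κ ≤ s.re →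
      ‖gaussianSmoothing g h s - g s‖ ≤ D * h := by
  obtain ⟨D, hD0, hD⟩ := exists_norm_deriv_le_of_bounded_halfPlane hg hC hκ
  have hint : Integrable (fun v : ℝ => |v|) (gaussianReal 0 1) :=
    ((memLp_id_gaussianReal (μ := 0) (v := 1) 1).integrable le_rfl).norm
  -- The mean value inequality bounds the integrand at `v` by `D h |v|`; averaging produces the
  -- first absolute moment.
  refine ⟨D * ∫ v : ℝ, |v| ∂(gaussianReal 0 1),
    mul_nonneg hD0 (integral_nonneg fun v => abs_nonneg v), fun h hh s hs => ?_⟩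
  have hsρ : ρ < s.re := hκ.trans_le hs
  have hi : Integrable (fun v : ℝ => g (s + ((h * v : ℝ) : ℂ) * Complex.I)) (gaussianReal 0 1) := by
    refine Integrable.of_bound
      (continuous_comp_vertical hg.continuousOn hsρ h).aestronglyMeasurable C
      (Eventually.of_forall fun v => hC _ ?_)
    rw [re_add_ofReal_mul_I]; exact hsρ
  have e : gaussianSmoothing g h s - g s =
      ∫ v : ℝ, (g (s + ((h * v : ℝ) : ℂ) * Complex.I) - g s) ∂(gaussianReal 0 1) := by
    rw [integral_sub hi (integrable_const _)]; simp [gaussianSmoothing]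
  rw [e, mul_right_comm, ← integral_const_mul]
  refine norm_integral_le_of_norm_le (hint.const_mul _) (Eventually.of_forall fun v => ?_)
  have hconv : Convex ℝ {z : ℂ | κ ≤ z.re} := convex_halfSpace_re_ge κ
  have := hconv.norm_image_sub_le_of_norm_deriv_le (f := g) (C := D) (x := s)
    (y := s + ((h * v : ℝ) : ℂ) * Complex.I)
    (fun z hz => hg.differentiableAt ((isOpen_halfPlane ρ).mem_nhds (hκ.trans_le hz)))
    (fun z hz => hD z hz) hs
    (show κ ≤ (s + ((h * v : ℝ) : ℂ) * Complex.I).re by rwa [re_add_ofReal_mul_I])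
  refine this.trans (le_of_eq ?_)
  rw [add_sub_cancel_left, norm_mul, Complex.norm_I, Complex.norm_real, Real.norm_eq_abs, abs_mul,
    abs_of_nonneg hh]
  ring

/-- A vertical shift multiplies `n^{-s}` by a character, so the average is the Gaussian
characteristic function at `-h log n`. -/
lemma integral_natCast_cpow_gaussianReal {n : ℕ} (hn : 1 ≤ n) (h : ℝ) (s : ℂ) :
    ∫ v : ℝ, (n : ℂ) ^ (-(s + ((h * v : ℝ) : ℂ) * Complex.I)) ∂(gaussianReal 0 1)
      = ((Real.exp (-(h * Real.log n) ^ 2 / 2) : ℝ) : ℂ) * (n : ℂ) ^ (-s) := by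
  have hn0 : (n : ℂ) ≠ 0 := by exact_mod_cast (by omega : n ≠ 0)
  have h1 := charFun_gaussianReal (μ := 0) (v := 1) (-(h * Real.log n))
  rw [charFun_apply_real] at h1
  have h2 : ∀ v : ℝ, (n : ℂ) ^ (-(s + ((h * v : ℝ) : ℂ) * Complex.I)) =
      Complex.exp (((-(h * Real.log n) : ℝ) : ℂ) * v * Complex.I) * (n : ℂ) ^ (-s) := by
    intro v
    rw [neg_add, Complex.cpow_add _ _ hn0, mul_comm, Complex.cpow_def_of_ne_zero hn0,
      ← Complex.natCast_log]
    congr 2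
    push_cast; ring
  simp only [h2]
  rw [integral_mul_const, h1]
  congr 1
  push_cast
  congr 1
  ring

/-- Completing the square gives `exp(-(h log n)²/2) n^y ≤ exp(y²/(2h²))` for every `y`. The choice
`y = Re s₀ + x + 2` absorbs the polynomial growth of the coefficients and leaves the summable factor
`n^{-2}`. -/
lemma summable_norm_mul_exp_neg_log_sq {a : ℕ → ℂ} {s₀ : ℂ} (ha : a 0 = 0)
    (hs₀ : DirichletConvergesAt a s₀) {h : ℝ} (hh : 0 < h) (x : ℝ) :
    Summable fun n : ℕ => ‖a n‖ * Real.exp (-(h * Real.log n) ^ 2 / 2) * (n : ℝ) ^ x := by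
  obtain ⟨B, hB0, hB⟩ := hs₀.exists_coeff_bound
  set y := s₀.re + x + 2
  refine Summable.of_nonneg_of_le (fun n => by positivity) (fun n => ?_)
    ((Real.summable_nat_rpow.2 (by norm_num : (-2 : ℝ) < -1)).mul_left
      (B * Real.exp (y ^ 2 / (2 * h ^ 2))))
  rcases Nat.eq_zero_or_pos n with rfl | hn
  · simp only [ha, norm_zero, zero_mul]; positivity
  have hn0 : (0 : ℝ) < n := by exact_mod_cast hn
  have key : Real.exp (-(h * Real.log n) ^ 2 / 2) * (n : ℝ) ^ y ≤ Real.exp (y ^ 2 / (2 * h ^ 2)) := by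
    rw [Real.rpow_def_of_pos hn0, ← Real.exp_add, Real.exp_le_exp]
    have : y ^ 2 / (2 * h ^ 2) - (-(h * Real.log n) ^ 2 / 2 + Real.log n * y)
        = (y / h - h * Real.log n) ^ 2 / 2 := by field_simp; ring
    nlinarith [sq_nonneg (y / h - h * Real.log n)]
  have e : (n : ℝ) ^ s₀.re * (n : ℝ) ^ x = (n : ℝ) ^ y * (n : ℝ) ^ (-2 : ℝ) := by
    rw [← Real.rpow_add hn0, ← Real.rpow_add hn0]; congr 1; simp only [y]; ring
  calc ‖a n‖ * Real.exp (-(h * Real.log n) ^ 2 / 2) * (n : ℝ) ^ x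
      ≤ (B * (n : ℝ) ^ s₀.re) * Real.exp (-(h * Real.log n) ^ 2 / 2) * (n : ℝ) ^ x := by
        gcongr; exact hB n hn
    _ = B * (Real.exp (-(h * Real.log n) ^ 2 / 2) * ((n : ℝ) ^ s₀.re * (n : ℝ) ^ x)) := by ring
    _ = B * (Real.exp (-(h * Real.log n) ^ 2 / 2) * (n : ℝ) ^ y) * (n : ℝ) ^ (-2 : ℝ) := by
        rw [e]; ring
    _ ≤ _ := by gcongr

/-- Gaussian smoothing multiplies the coefficients of a Dirichlet series bounded in a half-plane by
`exp (-(h log n)² / 2)`. -/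
lemma gaussianSmoothing_dirichletSum {a : ℕ → ℂ} (ha : a 0 = 0) {ρ : ℝ}
    (hb : DirichletBoundedOn a ρ) {h : ℝ} (hh : 0 < h) {s : ℂ} (hs : ρ < s.re) :
    gaussianSmoothing (dirichletSum a) h s =
      ∑' n : ℕ, a n * ((Real.exp (-(h * Real.log n) ^ 2 / 2) : ℝ) : ℂ) * (n : ℂ) ^ (-s) := by
  obtain ⟨hc, C, hC⟩ := hb
  have hopen := isOpen_halfPlane ρ
  have hg := differentiableOn_dirichletSum hc
  -- Sum and integral can be interchanged directly for `Re s > ρ + 2`, where the original series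
  -- converges absolutely. Both sides being analytic on `Re s > ρ`, the identity theorem extends the
  -- equality.
  have hL : AnalyticOnNhd ℂ (gaussianSmoothing (dirichletSum a) h) {s : ℂ | ρ < s.re} :=
    (differentiableOn_gaussianSmoothing hg hC h).analyticOnNhd hopen
  have hs₀ := hc ((ρ + 1 : ℝ) : ℂ) (by simp)
  have hR : AnalyticOnNhd ℂ (fun s : ℂ => ∑' n : ℕ,
      a n * ((Real.exp (-(h * Real.log n) ^ 2 / 2) : ℝ) : ℂ) * (n : ℂ) ^ (-s))
      {s : ℂ | ρ < s.re} := by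
    refine DifferentiableOn.analyticOnNhd ?_ hopen
    refine Complex.differentiableOn_tsum_of_summable_norm
      (summable_norm_mul_exp_neg_log_sq ha hs₀ hh (-ρ)) (fun n => ?_) hopen fun n s hs => ?_
    · rcases Nat.eq_zero_or_pos n with rfl | hn
      · simpa only [ha, zero_mul] using differentiableOn_const 0
      · have hn0 : (n : ℂ) ≠ 0 := by exact_mod_cast hn.ne'
        exact Differentiable.differentiableOn fun s =>
          ((differentiableAt_id.neg).const_cpow (Or.inl hn0)).const_mul _
    · rcases Nat.eq_zero_or_pos n with rfl | hn
      · simp [ha]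
      · rw [norm_mul, norm_mul, Complex.norm_natCast_cpow_of_pos hn, Complex.neg_re,
          Complex.norm_real, Real.norm_eq_abs, abs_of_pos (Real.exp_pos _)]
        refine mul_le_mul_of_nonneg_left (Real.rpow_le_rpow_of_exponent_le ?_ ?_) (by positivity)
        · exact_mod_cast hn
        · exact neg_le_neg (le_of_lt hs)
  have hpre : IsPreconnected {s : ℂ | ρ < s.re} := (convex_halfSpace_re_gt ρ).isPreconnected
  have hz : ((ρ + 3 : ℝ) : ℂ) ∈ {s : ℂ | ρ < s.re} := by simp
  refine hL.eqOn_of_preconnected_of_eventuallyEq hR hpre hz ?_ hs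
  have hz' : {s : ℂ | ρ + 2 < s.re} ∈ 𝓝 ((ρ + 3 : ℝ) : ℂ) :=
    (isOpen_halfPlane (ρ + 2)).mem_nhds (by simp; norm_num)
  filter_upwards [hz'] with s hs
  have hsum : Summable fun n : ℕ => ‖a n‖ * (n : ℝ) ^ (-s.re) :=
    hs₀.summable_norm ha (by simpa [add_assoc, one_add_one_eq_two] using hs)
  have hnorm : ∀ (n : ℕ) (v : ℝ), ‖a n * (n : ℂ) ^ (-(s + ((h * v : ℝ) : ℂ) * Complex.I))‖
      = ‖a n‖ * (n : ℝ) ^ (-s.re) := fun n v => by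
    rw [norm_coeff_mul_cpow ha, re_add_ofReal_mul_I]
  have hcont : ∀ n : ℕ, Continuous fun v : ℝ =>
      a n * (n : ℂ) ^ (-(s + ((h * v : ℝ) : ℂ) * Complex.I)) := by
    intro n
    rcases Nat.eq_zero_or_pos n with rfl | hn
    · simpa only [ha, zero_mul] using continuous_const
    · have hn0 : (n : ℂ) ≠ 0 := by exact_mod_cast hn.ne'
      exact continuous_const.mul (Continuous.const_cpow (by fun_prop) (Or.inl hn0))
  have h1 := hasSum_integral_of_summable_integral_norm (μ := gaussianReal 0 1)
    (F := fun (n : ℕ) (v : ℝ) => a n * (n : ℂ) ^ (-(s + ((h * v : ℝ) : ℂ) * Complex.I)))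
    (fun n => Integrable.of_bound (hcont n).aestronglyMeasurable (‖a n‖ * (n : ℝ) ^ (-s.re))
      (Eventually.of_forall fun v => (hnorm n v).le))
    (by simpa only [hnorm, integral_const, probReal_univ, one_smul] using hsum)
  rw [gaussianSmoothing]
  have h2 : ∀ v : ℝ, dirichletSum a (s + ((h * v : ℝ) : ℂ) * Complex.I) =
      ∑' n : ℕ, a n * (n : ℂ) ^ (-(s + ((h * v : ℝ) : ℂ) * Complex.I)) := fun v =>
    dirichletSum_eq_tsum ha (by simpa only [re_add_ofReal_mul_I] using hsum)
  simp only [h2]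
  rw [← h1.tsum_eq]
  refine tsum_congr fun n => ?_
  rcases Nat.eq_zero_or_pos n with rfl | hn
  · simp [ha]
  · rw [integral_const_mul, integral_natCast_cpow_gaussianReal hn, mul_assoc]

/-! ### Means over symmetric intervals and Parseval -/

/-- The mean of `φ` over `[-T, T]`. -/
noncomputable def symmMean (φ : ℝ → ℂ) (T : ℝ) : ℂ :=
  (((2 * T)⁻¹ : ℝ) : ℂ) * ∫ t in (-T)..T, φ t

lemma norm_symmMean_le {φ : ℝ → ℂ} {K : ℝ} (hφ : ∀ t, ‖φ t‖ ≤ K) {T : ℝ} (hT : 0 < T) :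
    ‖symmMean φ T‖ ≤ K := by
  have h1 : ‖∫ t in (-T)..T, φ t‖ ≤ K * |T - -T| :=
    intervalIntegral.norm_integral_le_of_norm_le_const fun t _ => hφ t
  rw [symmMean, norm_mul, Complex.norm_real, Real.norm_eq_abs, abs_of_pos (by positivity)]
  rw [abs_of_pos (by linarith)] at h1
  calc _ ≤ (2 * T)⁻¹ * (K * (T - -T)) := mul_le_mul_of_nonneg_left h1 (by positivity)
    _ = K := by field_simp; ring

/-- Means commute with absolutely convergent sums of uniformly bounded functions. -/
lemma tendsto_symmMean_tsum {c : ℕ → ℂ} (hc : Summable fun n => ‖c n‖) {φ : ℕ → ℝ → ℂ}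
    (hφc : ∀ n, Continuous (φ n)) {K : ℝ} (hφ : ∀ n t, ‖φ n t‖ ≤ K) {d : ℕ → ℂ}
    (hd : ∀ n, c n ≠ 0 → Tendsto (symmMean (φ n)) atTop (𝓝 (d n))) :
    Tendsto (symmMean fun t => ∑' n, c n * φ n t) atTop (𝓝 (∑' n, c n * d n)) := by
  have hs : Summable fun n => ‖c n‖ * K := hc.mul_right K
  have hterm : ∀ n t, ‖c n * φ n t‖ ≤ ‖c n‖ * K := fun n t => by
    rw [norm_mul]; exact mul_le_mul_of_nonneg_left (hφ n t) (norm_nonneg _)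
  have h1 : ∀ T : ℝ, symmMean (fun t => ∑' n, c n * φ n t) T
      = ∑' n, c n * symmMean (φ n) T := by
    intro T
    have h2 := intervalIntegral.hasSum_integral_of_dominated_convergence (μ := volume)
      (a := -T) (b := T) (F := fun n t => c n * φ n t) (f := fun t => ∑' n, c n * φ n t)
      (fun n _ => ‖c n‖ * K) (fun n => ((hφc n).const_mul _).aestronglyMeasurable)
      (fun n => Eventually.of_forall fun t _ => hterm n t)
      (Eventually.of_forall fun t _ => hs) intervalIntegrable_const
      (Eventually.of_forall fun t _ => (Summable.of_norm_bounded hs fun n => hterm n t).hasSum)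
    rw [symmMean, ← h2.tsum_eq, ← tsum_mul_left]
    refine tsum_congr fun n => ?_
    rw [intervalIntegral.integral_const_mul, symmMean]; ring
  simp only [funext h1]
  refine tendsto_tsum_of_dominated_convergence hs (fun n => ?_) ?_
  · by_cases hn : c n = 0
    · simp [hn]
    · exact (hd n hn).const_mul _
  · filter_upwards [eventually_gt_atTop 0] with T hT n
    rw [norm_mul]
    exact mul_le_mul_of_nonneg_left (norm_symmMean_le (hφ n) hT) (norm_nonneg _)

/-- The character `t ↦ e^{iθt}`. -/
noncomputable def realChar (θ t : ℝ) : ℂ := Complex.exp (((θ * t : ℝ) : ℂ) * Complex.I)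

lemma norm_realChar (θ t : ℝ) : ‖realChar θ t‖ = 1 := Complex.norm_exp_ofReal_mul_I _

lemma continuous_realChar (θ : ℝ) : Continuous (realChar θ) := by unfold realChar; fun_prop

/-- The integral of a nontrivial character is at most `2 / |θ|` for all `T`, and the mean divides it
by `2T`. -/
lemma tendsto_symmMean_realChar {θ : ℝ} (hθ : θ ≠ 0) :
    Tendsto (symmMean (realChar θ)) atTop (𝓝 0) := by
  have hc : (θ : ℂ) * Complex.I ≠ 0 := by simp [hθ]
  have h1 : ∀ T : ℝ, ‖∫ t in (-T)..T, realChar θ t‖ ≤ 2 / |θ| := by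
    intro T
    have e : ∀ t : ℝ, realChar θ t = Complex.exp (((θ : ℂ) * Complex.I) * t) := fun t => by
      rw [realChar]; congr 1; push_cast; ring
    simp only [e]
    rw [integral_exp_mul_complex hc, norm_div]
    simp only [← e]
    rw [norm_mul, Complex.norm_I, mul_one, Complex.norm_real, Real.norm_eq_abs]
    gcongr
    refine (norm_sub_le _ _).trans ?_
    rw [norm_realChar, norm_realChar]; norm_num
  have h2 : Tendsto (fun T : ℝ => (2 * T)⁻¹ * (2 / |θ|)) atTop (𝓝 0) := by
    have : Tendsto (fun T : ℝ => (2 * T)⁻¹) atTop (𝓝 0) :=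
      tendsto_inv_atTop_zero.comp (tendsto_id.const_mul_atTop two_pos)
    simpa using this.mul_const (2 / |θ|)
  refine squeeze_zero_norm' ?_ h2
  filter_upwards [eventually_gt_atTop 0] with T hT
  rw [symmMean, norm_mul, Complex.norm_real, Real.norm_eq_abs, abs_of_pos (by positivity)]
  exact mul_le_mul_of_nonneg_left (h1 T) (by positivity)

lemma symmMean_const (z : ℂ) {T : ℝ} (hT : 0 < T) : symmMean (fun _ => z) T = z := by
  rw [symmMean, intervalIntegral.integral_const, ← Complex.coe_smul, smul_eq_mul, ← mul_assoc,
    ← Complex.ofReal_mul]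
  have : (2 * T)⁻¹ * (T - -T) = 1 := by field_simp; ring
  rw [this]; simp

/-- Parseval for absolutely convergent almost periodic series with distinct frequencies. -/
lemma tendsto_mean_norm_sq_tsum {c : ℕ → ℂ} (hc : Summable fun n => ‖c n‖) {θ : ℕ → ℝ}
    (hθ : ∀ m n, c m ≠ 0 → c n ≠ 0 → θ m = θ n → m = n) :
    Tendsto (fun T : ℝ => (2 * T)⁻¹ * ∫ t in (-T)..T, ‖∑' n, c n * realChar (θ n) t‖ ^ 2) atTop
      (𝓝 (∑' n, ‖c n‖ ^ 2)) := by
  set F : ℝ → ℂ := fun t => ∑' n, c n * realChar (θ n) t with hF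
  have hterm : ∀ n t, ‖c n * realChar (θ n) t‖ ≤ ‖c n‖ := fun n t => by
    rw [norm_mul, norm_realChar, mul_one]
  have hsum : ∀ t, Summable fun n => c n * realChar (θ n) t := fun t =>
    Summable.of_norm_bounded hc fun n => hterm n t
  have hFc : Continuous F :=
    continuous_tsum (fun n => (continuous_realChar (θ n)).const_mul _) hc hterm
  have hFb : ∀ t, ‖F t‖ ≤ ∑' n, ‖c n‖ := fun t => tsum_of_norm_bounded hc.hasSum fun n => hterm n t
  have hchar : ∀ x y t, realChar x t * realChar (-y) t = realChar (x - y) t := fun x y t => by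
    rw [realChar, realChar, realChar, ← Complex.exp_add]; congr 1; push_cast; ring
  have hconj : ∀ x t, starRingEnd ℂ (realChar x t) = realChar (-x) t := fun x t => by
    rw [realChar, realChar, ← Complex.exp_conj]; congr 1
    simp
  -- Fourier coefficients are recovered as means: only the frequency `θ m` survives multiplication
  -- by the character of `-θ m`.
  have hcoef : ∀ m, c m ≠ 0 →
      Tendsto (symmMean fun t => F t * realChar (-θ m) t) atTop (𝓝 (c m)) := by
    intro m hm
    have h1 := tendsto_symmMean_tsum hc (φ := fun n => realChar (θ n - θ m)) (K := 1)
      (d := fun n => if n = m then 1 else 0) (fun n => continuous_realChar _)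
      (fun n t => (norm_realChar _ _).le) (fun n hn => ?_)
    · simp only [mul_ite, mul_one, mul_zero, tsum_ite_eq] at h1
      refine h1.congr fun T => ?_
      congr 1; ext t
      rw [hF, ← tsum_mul_right]
      exact tsum_congr fun n => by rw [mul_assoc, hchar]
    · by_cases hnm : n = m
      · subst hnm
        simp only [if_true, sub_self]
        refine (tendsto_const_nhds (x := (1 : ℂ))).congr' ?_
        filter_upwards [eventually_gt_atTop 0] with T hT
        rw [show realChar 0 = fun _ => 1 by ext t; simp [realChar], symmMean_const 1 hT]
      · simp only [hnm, if_false]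
        exact tendsto_symmMean_realChar (sub_ne_zero.2 fun e => hnm (hθ n m hn hm e))
  -- A second termwise mean, now for `|F|² = ∑ conj(c m) F e^{-iθ_m t}`, whose `m`-th term has mean
  -- `conj(c m) c m`.
  have h2 := tendsto_symmMean_tsum (c := fun n => starRingEnd ℂ (c n))
    (by simpa only [RCLike.norm_conj] using hc)
    (φ := fun m t => F t * realChar (-θ m) t) (K := ∑' n, ‖c n‖) (d := c)
    (fun n => hFc.mul (continuous_realChar _))
    (fun n t => by rw [norm_mul, norm_realChar, mul_one]; exact hFb t)
    (fun n hn => hcoef n fun h => hn (by simp [h]))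
  have hlim : ∑' n, starRingEnd ℂ (c n) * c n = ((∑' n, ‖c n‖ ^ 2 : ℝ) : ℂ) := by
    rw [Complex.ofReal_tsum]
    exact tsum_congr fun n => by rw [Complex.conj_mul']; push_cast; rfl
  rw [hlim] at h2
  have h3 := (Complex.continuous_re.tendsto _).comp h2
  rw [Complex.ofReal_re] at h3
  refine h3.congr fun T => ?_
  have h4 : (fun t => ∑' n, starRingEnd ℂ (c n) * (F t * realChar (-θ n) t))
      = fun t => ((‖F t‖ ^ 2 : ℝ) : ℂ) := by
    ext t
    have : ∀ n, starRingEnd ℂ (c n) * (F t * realChar (-θ n) t)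
        = starRingEnd ℂ (c n * realChar (θ n) t) * F t := fun n => by
      rw [map_mul, hconj]; ring
    simp only [this]
    rw [tsum_mul_right, ← Complex.conj_tsum]
    change starRingEnd ℂ (F t) * F t = _
    rw [Complex.conj_mul']; push_cast; rfl
  simp only [Function.comp, h4, symmMean]
  rw [intervalIntegral.integral_ofReal, ← Complex.ofReal_mul, Complex.ofReal_re]

/-! ### Carlson's theorem -/

/-- Parseval for the Gaussian smoothing of a Dirichlet series bounded in a half-plane. -/
lemma tendsto_mean_norm_sq_gaussianSmoothing {a : ℕ → ℂ} (ha : a 0 = 0) {ρ κ : ℝ}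
    (hb : DirichletBoundedOn a ρ) (hκ : ρ < κ) {h : ℝ} (hh : 0 < h) :
    (Summable fun n : ℕ => (‖a n‖ * Real.exp (-(h * Real.log n) ^ 2 / 2) * (n : ℝ) ^ (-κ)) ^ 2) ∧
    Tendsto (fun T : ℝ => (2 * T)⁻¹ * ∫ t in (-T)..T,
        ‖gaussianSmoothing (dirichletSum a) h (κ + t * Complex.I)‖ ^ 2) atTop
      (𝓝 (∑' n : ℕ, (‖a n‖ * Real.exp (-(h * Real.log n) ^ 2 / 2) * (n : ℝ) ^ (-κ)) ^ 2)) := by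
  set c : ℕ → ℂ := fun n =>
    a n * ((Real.exp (-(h * Real.log n) ^ 2 / 2) : ℝ) : ℂ) * (n : ℂ) ^ (-(κ : ℂ)) with hc
  have hcn : ∀ n, ‖c n‖ = ‖a n‖ * Real.exp (-(h * Real.log n) ^ 2 / 2) * (n : ℝ) ^ (-κ) := by
    intro n
    rcases Nat.eq_zero_or_pos n with rfl | hn
    · simp [hc, ha]
    · simp only [hc]
      rw [norm_mul, norm_mul, Complex.norm_natCast_cpow_of_pos hn, Complex.neg_re,
        Complex.norm_real, Real.norm_eq_abs, abs_of_pos (Real.exp_pos _), Complex.ofReal_re]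
  have hsum : Summable fun n => ‖c n‖ := by
    simp only [hcn]
    exact summable_norm_mul_exp_neg_log_sq ha (hb.1 ((ρ + 1 : ℝ) : ℂ) (by simp)) hh (-κ)
  -- `Real.log 0 = Real.log 1 = 0`, so indices `0` and `1` share a frequency; index `0` is discarded
  -- because `a 0 = 0`.
  have hpos : ∀ n, c n ≠ 0 → 0 < n := fun n hn =>
    Nat.pos_of_ne_zero fun h0 => hn (by simp [hc, h0, ha])
  have h1 := tendsto_mean_norm_sq_tsum hsum (θ := fun n => -Real.log n) fun m n hm hn hmn => by
    have h2 := Real.log_injOn_pos (Set.mem_Ioi.2 (by exact_mod_cast hpos m hm))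
      (Set.mem_Ioi.2 (by exact_mod_cast hpos n hn)) (neg_injective hmn)
    exact_mod_cast h2
  simp only [← hcn]
  refine ⟨?_, h1.congr fun T => ?_⟩
  · have hev : ∀ᶠ n in cofinite, ‖c n‖ < 1 :=
      hsum.tendsto_cofinite_zero.eventually (gt_mem_nhds one_pos)
    refine Summable.of_norm_bounded_eventually hsum ?_
    filter_upwards [hev] with n hn
    rw [norm_pow, norm_norm, sq]
    exact mul_le_of_le_one_left (norm_nonneg _) hn.le
  · congr 1
    refine intervalIntegral.integral_congr fun t _ => ?_
    rw [gaussianSmoothing_dirichletSum ha hb hh (by simpa using hκ)]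
    congr 2
    refine tsum_congr fun n => ?_
    rcases Nat.eq_zero_or_pos n with rfl | hn
    · simp [hc, ha]
    · have hn0 : (n : ℂ) ≠ 0 := by exact_mod_cast hn.ne'
      simp only [hc]
      rw [neg_add, Complex.cpow_add _ _ hn0, ← mul_assoc]
      congr 1
      rw [realChar, Complex.cpow_def_of_ne_zero hn0, ← Complex.natCast_log]
      congr 1; push_cast; ring

/-- Carlson's mean value theorem for Dirichlet series bounded in a half-plane. -/
lemma tendsto_mean_norm_sq_dirichletSum {a : ℕ → ℂ} (ha : a 0 = 0) {ρ κ : ℝ}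
    (hb : DirichletBoundedOn a ρ) (hκ : ρ < κ) :
    (Summable fun n : ℕ => (‖a n‖ * (n : ℝ) ^ (-κ)) ^ 2) ∧
    Tendsto (fun T : ℝ => (2 * T)⁻¹ * ∫ t in (-T)..T,
        ‖dirichletSum a (κ + t * Complex.I)‖ ^ 2) atTop
      (𝓝 (∑' n : ℕ, (‖a n‖ * (n : ℝ) ^ (-κ)) ^ 2)) := by
  obtain ⟨C, hC⟩ := hb.2
  have hC0 : 0 ≤ C := (norm_nonneg _).trans (hC ((ρ + 1 : ℝ) : ℂ) (by simp))
  have hg := differentiableOn_dirichletSum hb.1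
  obtain ⟨D, hD0, hD⟩ := exists_norm_gaussianSmoothing_sub_le hg hC hκ
  have hre : ∀ t : ℝ, ((κ : ℂ) + t * Complex.I).re = κ := fun t => by simp
  have hPC : ∀ h : ℝ, ∀ t : ℝ,
      ‖gaussianSmoothing (dirichletSum a) h (κ + t * Complex.I)‖ ≤ C := by
    intro h t
    refine (norm_integral_le_of_norm_le_const (C := C) (Eventually.of_forall fun v => hC _ ?_)).trans
      (by simp)
    rw [re_add_ofReal_mul_I, hre]; exact hκ
  have hline : ∀ {g : ℂ → ℂ}, DifferentiableOn ℂ g {s : ℂ | ρ < s.re} →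
      Continuous fun t : ℝ => ‖g (κ + t * Complex.I)‖ ^ 2 := by
    intro g hg
    refine (Continuous.norm (hg.continuousOn.comp_continuous (by fun_prop) fun t => ?_)).pow 2
    rw [Set.mem_ofPred_eq, hre]; exact hκ
  have hfl := hline hg
  have hPl := fun h => hline (differentiableOn_gaussianSmoothing hg hC h)
  set η : ℕ → ℝ := fun k => 1 / ((k : ℝ) + 1) with hη
  have hη0 : Tendsto η atTop (𝓝 0) := tendsto_one_div_add_atTop_nhds_zero_nat
  have hηpos : ∀ k, 0 < η k := fun k => by simp only [hη]; positivity
  set w : ℕ → ℕ → ℝ := fun k n =>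
    (‖a n‖ * Real.exp (-(η k * Real.log n) ^ 2 / 2) * (n : ℝ) ^ (-κ)) ^ 2 with hw
  have hmean := fun k => tendsto_mean_norm_sq_gaussianSmoothing ha hb hκ (hηpos k)
  -- Averaging does not increase the supremum bound `C`, so the smoothed square sums are at most `C
  -- ^ 2`, uniformly in the scale.
  have hmC : ∀ k, ∑' n, w k n ≤ C ^ 2 := by
    intro k
    refine le_of_tendsto (hmean k).2 ?_
    filter_upwards [eventually_gt_atTop 0] with T hT
    have h1 : ∫ t in (-T)..T, ‖gaussianSmoothing (dirichletSum a) (η k) (κ + t * Complex.I)‖ ^ 2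
        ≤ ∫ _ in (-T)..T, C ^ 2 :=
      intervalIntegral.integral_mono_on (by linarith) ((hPl _).intervalIntegrable _ _)
        intervalIntegrable_const fun t _ => pow_le_pow_left₀ (norm_nonneg _) (hPC _ t) 2
    rw [intervalIntegral.integral_const, smul_eq_mul] at h1
    calc _ ≤ (2 * T)⁻¹ * ((T - -T) * C ^ 2) := mul_le_mul_of_nonneg_left h1 (by positivity)
      _ = C ^ 2 := by field_simp; ring
  have hwlim : ∀ n, Tendsto (fun k => w k n) atTop (𝓝 ((‖a n‖ * (n : ℝ) ^ (-κ)) ^ 2)) := by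
    intro n
    have hcont : Continuous fun h : ℝ =>
        (‖a n‖ * Real.exp (-(h * Real.log n) ^ 2 / 2) * (n : ℝ) ^ (-κ)) ^ 2 := by fun_prop
    have h1 := (hcont.tendsto 0).comp hη0
    rw [show (‖a n‖ * Real.exp (-(0 * Real.log n) ^ 2 / 2) * (n : ℝ) ^ (-κ)) ^ 2 =
      (‖a n‖ * (n : ℝ) ^ (-κ)) ^ 2 by simp] at h1
    exact h1
  -- A Fatou argument: each finite partial sum is a limit of smoothed ones, hence at most `C ^ 2`.
  have hsummable : Summable fun n : ℕ => (‖a n‖ * (n : ℝ) ^ (-κ)) ^ 2 := by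
    refine summable_of_sum_le (c := C ^ 2) (fun n => by positivity) fun s => ?_
    refine le_of_tendsto (tendsto_finsetSum s fun n _ => hwlim n) (Eventually.of_forall fun k => ?_)
    exact ((hmean k).1.sum_le_tsum s fun n _ => by positivity).trans (hmC k)
  refine ⟨hsummable, ?_⟩
  have hmlim : Tendsto (fun k => ∑' n, w k n) atTop (𝓝 (∑' n : ℕ, (‖a n‖ * (n : ℝ) ^ (-κ)) ^ 2)) := by
    refine tendsto_tsum_of_dominated_convergence hsummable hwlim
      (Eventually.of_forall fun k n => ?_)
    rw [Real.norm_eq_abs, abs_of_nonneg (by positivity)]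
    refine pow_le_pow_left₀ (by positivity) (mul_le_mul_of_nonneg_right ?_ (by positivity)) 2
    refine mul_le_of_le_one_right (norm_nonneg _) (Real.exp_le_one_iff.2 ?_)
    nlinarith [sq_nonneg (η k * Real.log n)]
  -- From `|x² - y²| ≤ (x + y)|x - y|` with `x, y ≤ C`, the means differ by at most `2C · D · η k`
  -- for every `T > 0`. This uniformity in `T` justifies exchanging the two limits.
  have hunif : TendstoUniformlyOn (fun (k : ℕ) (T : ℝ) => (2 * T)⁻¹ * ∫ t in (-T)..T,
        ‖gaussianSmoothing (dirichletSum a) (η k) (κ + t * Complex.I)‖ ^ 2)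
      (fun T : ℝ => (2 * T)⁻¹ * ∫ t in (-T)..T, ‖dirichletSum a (κ + t * Complex.I)‖ ^ 2)
      atTop (Set.Ioi 0) := by
    rw [Metric.tendstoUniformlyOn_iff]
    intro ε hε
    have h0 : Tendsto (fun k => 2 * C * (D * η k)) atTop (𝓝 0) := by
      simpa only [mul_zero] using (hη0.const_mul D).const_mul (2 * C)
    filter_upwards [h0.eventually (gt_mem_nhds hε)] with k hk T hT
    have hT : 0 < T := hT
    refine lt_of_le_of_lt ?_ hk
    rw [dist_eq_norm, ← mul_sub,
      ← intervalIntegral.integral_sub (hfl.intervalIntegrable _ _) ((hPl _).intervalIntegrable _ _),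
      norm_mul, Real.norm_of_nonneg (by positivity : 0 ≤ (2 * T)⁻¹)]
    have h1 : ‖∫ t in (-T)..T, (‖dirichletSum a (κ + t * Complex.I)‖ ^ 2 -
        ‖gaussianSmoothing (dirichletSum a) (η k) (κ + t * Complex.I)‖ ^ 2)‖
        ≤ 2 * C * (D * η k) * |T - -T| := by
      refine intervalIntegral.norm_integral_le_of_norm_le_const fun t _ => ?_
      have h2 := hD (η k) (hηpos k).le (κ + t * Complex.I) (hre t).ge
      have h3 := hC (κ + t * Complex.I) (by rw [hre]; exact hκ)
      have h4 := hPC (η k) t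
      have h5 := abs_norm_sub_norm_le (dirichletSum a (κ + t * Complex.I))
        (gaussianSmoothing (dirichletSum a) (η k) (κ + t * Complex.I))
      rw [norm_sub_rev] at h5
      rw [sq_sub_sq, norm_mul, Real.norm_eq_abs, Real.norm_eq_abs, abs_of_nonneg (by positivity)]
      exact mul_le_mul (by linarith) (h5.trans h2) (abs_nonneg _) (by positivity)
    rw [abs_of_pos (by linarith)] at h1
    calc _ ≤ (2 * T)⁻¹ * (2 * C * (D * η k) * (T - -T)) :=
          mul_le_mul_of_nonneg_left h1 (by positivity)
      _ = _ := by field_simp; ring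
  exact (hunif.tendstoUniformlyOnFilter.mono_right
    (le_principal_iff.2 (Ioi_mem_atTop 0))).tendsto_of_eventually_tendsto
    (Eventually.of_forall fun k => (hmean k).2) hmlim

/-! ### Integration against `μ` and the limit `c → 0⁺` -/

lemma exists_dirichletBoundedOn_lt {a : ℕ → ℂ} {c : ℝ} (hσb : abscissaOfBoundedness a = 0)
    (hc : 0 < c) : ∃ ρ < c, DirichletBoundedOn a ρ := by
  have h1 : abscissaOfBoundedness a < (c : EReal) := by rw [hσb]; exact_mod_cast hc
  obtain ⟨_, ⟨ρ, hρ, rfl⟩, h2⟩ := sInf_lt_iff.1 h1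
  exact ⟨ρ, EReal.coe_lt_coe_iff.1 h2, hρ⟩

lemma rpow_neg_sq {x : ℝ} (hx : 0 ≤ x) (y : ℝ) : (x ^ (-y)) ^ 2 = x ^ (-2 * y) := by
  rw [← Real.rpow_mul_natCast hx]; congr 1; push_cast; ring

/-- Tonelli: the mean as an integral over `σ` of means over vertical segments. -/
lemma dirichletMean_eq_lintegral {μ : Measure ℝ≥0} [SFinite μ] {a : ℕ → ℂ} {ρ c : ℝ}
    (hb : DirichletBoundedOn a ρ) (hc : ρ < c) {T : ℝ} (hT : 0 < T) :
    (∀ T : ℝ, 0 < T → Measurable fun σ : ℝ≥0 => ENNReal.ofReal ((2 * T)⁻¹ * ∫ t in (-T)..T,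
        ‖dirichletSum a (((σ + c : ℝ) : ℂ) + t * Complex.I)‖ ^ 2)) ∧
    dirichletMean μ a c T = ∫⁻ σ : ℝ≥0, ENNReal.ofReal ((2 * T)⁻¹ * ∫ t in (-T)..T,
        ‖dirichletSum a (((σ + c : ℝ) : ℂ) + t * Complex.I)‖ ^ 2) ∂μ := by
  have hcont : Continuous fun p : ℝ × ℝ≥0 =>
      ‖dirichletSum a (((p.2 : ℝ) : ℂ) + (p.1 : ℂ) * Complex.I + (c : ℂ))‖ ^ 2 := by
    refine (Continuous.norm ((differentiableOn_dirichletSum hb.1).continuousOn.comp_continuous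
      (by fun_prop) fun p => ?_)).pow 2
    have : (0 : ℝ) ≤ p.2 := p.2.2
    simp only [Set.mem_ofPred_eq, Complex.add_re, Complex.ofReal_re, Complex.mul_re, Complex.I_re,
      Complex.ofReal_im, Complex.I_im]
    linarith
  have hmeas : Measurable fun p : ℝ × ℝ≥0 => ENNReal.ofReal
      (‖dirichletSum a (((p.2 : ℝ) : ℂ) + (p.1 : ℂ) * Complex.I + (c : ℂ))‖ ^ 2) :=
    hcont.measurable.ennreal_ofReal
  have hinner : ∀ T : ℝ, 0 < T → ∀ σ : ℝ≥0, ENNReal.ofReal ((2 * T)⁻¹ * ∫ t in (-T)..T,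
        ‖dirichletSum a (((σ + c : ℝ) : ℂ) + t * Complex.I)‖ ^ 2) =
      (ENNReal.ofReal (2 * T))⁻¹ * ∫⁻ t in Set.Icc (-T) T, ENNReal.ofReal
        (‖dirichletSum a (((σ : ℝ) : ℂ) + (t : ℂ) * Complex.I + (c : ℂ))‖ ^ 2) := by
    intro T hT σ
    have hcσ : Continuous fun t : ℝ =>
        ‖dirichletSum a (((σ : ℝ) : ℂ) + (t : ℂ) * Complex.I + (c : ℂ))‖ ^ 2 := by
      have h := hcont.comp (Continuous.prodMk_left (X := ℝ) σ)
      simpa only [Function.comp_def] using h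
    have hi : IntegrableOn (fun t : ℝ =>
        ‖dirichletSum a (((σ : ℝ) : ℂ) + (t : ℂ) * Complex.I + (c : ℂ))‖ ^ 2) (Set.Icc (-T) T) :=
      hcσ.continuousOn.integrableOn_compact isCompact_Icc
    have h1 := ofReal_integral_eq_lintegral_ofReal hi
      (Eventually.of_forall fun t => sq_nonneg _)
    have h2 : ∀ t : ℝ, ((σ + c : ℝ) : ℂ) + t * Complex.I
        = ((σ : ℝ) : ℂ) + (t : ℂ) * Complex.I + (c : ℂ) := fun t => by push_cast; ring
    rw [← h1, ENNReal.ofReal_mul (by positivity), ENNReal.ofReal_inv_of_pos (by positivity),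
      intervalIntegral.integral_of_le (by linarith), integral_Icc_eq_integral_Ioc]
    simp only [h2]
  refine ⟨fun T hT => ?_, ?_⟩
  · simp only [hinner T hT]
    exact (hmeas.lintegral_prod_left' ).const_mul _
  · simp only [hinner T hT]
    rw [lintegral_const_mul _ hmeas.lintegral_prod_left', dirichletMean]
    congr 1
    exact lintegral_lintegral_swap hmeas.aemeasurable

/-- Dominated convergence in `σ`, with Carlson's theorem at abscissa `σ + c` as the pointwise limit.
A constant bound on `f` would not do when `μ` has infinite mass; the decay `O(n₀^{-Re s})` gives a
majorant proportional to `n₀^{-2σ}`, independent of `T` and integrable by `hμ`. -/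
lemma tendsto_dirichletMean {n₀ : ℕ} (hn₀ : 1 ≤ n₀) {μ : Measure ℝ≥0} [SFinite μ]
    (hμ : dirichletWeight μ n₀ < ∞) {a : ℕ → ℂ} (ha : ∀ n < n₀, a n = 0) {ρ c : ℝ}
    (hb : DirichletBoundedOn a ρ) (hc : ρ < c) :
    Tendsto (fun T : ℝ => dirichletMean μ a c T) atTop
      (𝓝 (∑' n : ℕ, ENNReal.ofReal (‖a n‖ ^ 2 * (n : ℝ) ^ (-2 * c)) * dirichletWeight μ n)) := by
  have ha0 : a 0 = 0 := ha 0 hn₀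
  have hn0 : (0 : ℝ) < n₀ := by exact_mod_cast hn₀
  obtain ⟨C, hC0, hC⟩ := hb.exists_decay hn₀ ha
  have hσc : ∀ σ : ℝ≥0, ρ < σ + c := fun σ => by have : (0 : ℝ) ≤ σ := σ.2; linarith
  have hcarl := fun σ : ℝ≥0 => tendsto_mean_norm_sq_dirichletSum ha0 hb (hσc σ)
  have hterm : ∀ (n : ℕ) (σ : ℝ≥0), ENNReal.ofReal ((‖a n‖ * (n : ℝ) ^ (-(σ + c : ℝ))) ^ 2) =
      ENNReal.ofReal (‖a n‖ ^ 2 * (n : ℝ) ^ (-2 * c)) *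
        ENNReal.ofReal ((n : ℝ) ^ (-2 * (σ : ℝ))) := by
    intro n σ
    rw [← ENNReal.ofReal_mul (by positivity)]
    congr 1
    rcases Nat.eq_zero_or_pos n with rfl | hn
    · simp [ha0]
    · have hnn : (0 : ℝ) < n := by exact_mod_cast hn
      rw [mul_pow, mul_assoc, ← Real.rpow_add hnn, rpow_neg_sq hnn.le]
      congr 2
      ring
  have hlim : ∑' n : ℕ, ENNReal.ofReal (‖a n‖ ^ 2 * (n : ℝ) ^ (-2 * c)) * dirichletWeight μ n =
      ∫⁻ σ : ℝ≥0, ENNReal.ofReal (∑' n : ℕ, (‖a n‖ * (n : ℝ) ^ (-(σ + c : ℝ))) ^ 2) ∂μ := by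
    have h1 : ∀ σ : ℝ≥0, ENNReal.ofReal (∑' n : ℕ, (‖a n‖ * (n : ℝ) ^ (-(σ + c : ℝ))) ^ 2) =
        ∑' n : ℕ, ENNReal.ofReal (‖a n‖ ^ 2 * (n : ℝ) ^ (-2 * c)) *
          ENNReal.ofReal ((n : ℝ) ^ (-2 * (σ : ℝ))) := fun σ => by
      rw [ENNReal.ofReal_tsum_of_nonneg (fun n => by positivity) (hcarl σ).1]
      exact tsum_congr fun n => hterm n σ
    have hm : ∀ n : ℕ, Measurable fun σ : ℝ≥0 => ENNReal.ofReal ((n : ℝ) ^ (-2 * (σ : ℝ))) :=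
      fun n => by fun_prop
    simp only [h1]
    rw [lintegral_tsum fun n => ((hm n).const_mul _).aemeasurable]
    exact tsum_congr fun n => by rw [lintegral_const_mul _ (hm n), dirichletWeight]
  rw [hlim]
  have hE : (fun T : ℝ => dirichletMean μ a c T) =ᶠ[atTop] fun T =>
      ∫⁻ σ : ℝ≥0, ENNReal.ofReal ((2 * T)⁻¹ * ∫ t in (-T)..T,
        ‖dirichletSum a (((σ + c : ℝ) : ℂ) + t * Complex.I)‖ ^ 2) ∂μ := by
    filter_upwards [eventually_gt_atTop 0] with T hT
    exact (dirichletMean_eq_lintegral hb hc hT).2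
  refine Tendsto.congr' hE.symm ?_
  refine tendsto_lintegral_filter_of_dominated_convergence
    (fun σ : ℝ≥0 => ENNReal.ofReal ((C * (n₀ : ℝ) ^ (-c)) ^ 2) *
      ENNReal.ofReal ((n₀ : ℝ) ^ (-2 * (σ : ℝ)))) ?_ ?_ ?_ ?_
  · filter_upwards [eventually_gt_atTop 0] with T hT
    exact (dirichletMean_eq_lintegral (μ := μ) hb hc hT).1 T hT
  · filter_upwards [eventually_gt_atTop 0] with T hT
    refine Eventually.of_forall fun σ => ?_
    rw [← ENNReal.ofReal_mul (by positivity)]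
    refine ENNReal.ofReal_le_ofReal ?_
    have h1 : ∀ t : ℝ, ‖‖dirichletSum a (((σ + c : ℝ) : ℂ) + t * Complex.I)‖ ^ 2‖
        ≤ (C * (n₀ : ℝ) ^ (-c)) ^ 2 * (n₀ : ℝ) ^ (-2 * (σ : ℝ)) := by
      intro t
      have h2 := hC (((σ + c : ℝ) : ℂ) + t * Complex.I)
        (by rw [re_add_ofReal_mul_I, Complex.ofReal_re]; exact hσc σ)
      rw [re_add_ofReal_mul_I, Complex.ofReal_re] at h2
      rw [norm_pow, norm_norm]
      refine (pow_le_pow_left₀ (norm_nonneg _) h2 2).trans (le_of_eq ?_)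
      rw [mul_pow, mul_pow, mul_assoc, rpow_neg_sq hn0.le, rpow_neg_sq hn0.le,
        ← Real.rpow_add hn0]
      congr 2
      ring
    have h3 := (le_abs_self _).trans (intervalIntegral.norm_integral_le_of_norm_le_const
      (a := -T) (b := T) fun t _ => h1 t)
    rw [abs_of_pos (by linarith)] at h3
    calc _ ≤ _ := mul_le_mul_of_nonneg_left h3 (by positivity)
      _ = _ := by field_simp; ring
  · rw [lintegral_const_mul _ (by fun_prop)]
    exact ENNReal.mul_ne_top ENNReal.ofReal_ne_top hμ.ne
  · refine Eventually.of_forall fun σ => ?_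
    exact (ENNReal.continuous_ofReal.tendsto _).comp (hcarl σ).2

lemma dirichletWeight_antitone (μ : Measure ℝ≥0) {m n : ℕ} (hm : 1 ≤ m) (hmn : m ≤ n) :
    dirichletWeight μ n ≤ dirichletWeight μ m := by
  refine lintegral_mono fun σ => ENNReal.ofReal_le_ofReal ?_
  have : (0 : ℝ) ≤ σ := σ.2
  exact Real.rpow_le_rpow_of_nonpos (by exact_mod_cast hm) (by exact_mod_cast hmn) (by linarith)

/-- Abel-type continuity of `∑ bₙ n^{-2c} wₙ` as `c → 0⁺`, with values in `[0, ∞]`. -/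
lemma tendsto_tsum_rpow_mul {b : ℕ → ℝ} (hb : ∀ n, 0 ≤ b n) (hb0 : b 0 = 0) {w : ℕ → ℝ≥0∞}
    (hw : ∀ n, b n ≠ 0 → w n ≠ ∞) :
    Tendsto (fun c : ℝ => ∑' n : ℕ, ENNReal.ofReal (b n * (n : ℝ) ^ (-2 * c)) * w n) (𝓝[>] 0)
      (𝓝 (∑' n : ℕ, ENNReal.ofReal (b n) * w n)) := by
  -- Any value below the limit is exceeded by a finite partial sum, which is continuous in `c`; for
  -- `c > 0` every term is at most its value at `c = 0`. Neither half needs the limit to be finite.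
  refine tendsto_order.2 ⟨fun x hx => ?_, fun x hx => ?_⟩
  · rw [ENNReal.tsum_eq_iSup_sum] at hx
    obtain ⟨s, hs⟩ := lt_iSup_iff.1 hx
    have h1 : Tendsto (fun c : ℝ => ∑ n ∈ s, ENNReal.ofReal (b n * (n : ℝ) ^ (-2 * c)) * w n)
        (𝓝[>] 0) (𝓝 (∑ n ∈ s, ENNReal.ofReal (b n) * w n)) := by
      refine tendsto_finsetSum s fun n _ => ?_
      by_cases hn : b n = 0
      · simp [hn]
      have hn0 : (n : ℝ) ≠ 0 := by
        rintro h; exact hn (by rw [Nat.cast_eq_zero.1 h, hb0])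
      refine ENNReal.Tendsto.mul_const ?_ (Or.inr (hw n hn))
      have hc : Continuous fun c : ℝ => b n * (n : ℝ) ^ (-2 * c) :=
        continuous_const.mul (Real.continuous_const_rpow hn0 |>.comp (by fun_prop))
      have h2 := (ENNReal.continuous_ofReal.comp hc).tendsto 0
      simp only [Function.comp, mul_zero, Real.rpow_zero, mul_one] at h2
      exact h2.mono_left nhdsWithin_le_nhds
    filter_upwards [h1.eventually (lt_mem_nhds hs)] with c hc
    exact hc.trans_le (ENNReal.sum_le_tsum s)
  · filter_upwards [self_mem_nhdsWithin] with c hc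
    have hc : 0 < c := hc
    refine lt_of_le_of_lt (ENNReal.tsum_le_tsum fun n => ?_) hx
    refine mul_le_mul_left (ENNReal.ofReal_le_ofReal ?_) _
    rcases Nat.eq_zero_or_pos n with rfl | hn
    · simp [hb0]
    · exact mul_le_of_le_one_right (hb n)
        (Real.rpow_le_one_of_one_le_of_nonpos (by exact_mod_cast hn) (by linarith))

theorem mainTheorem2 (n₀ : ℕ) (hn₀ : 1 ≤ n₀)
    (μ : Measure ℝ≥0) [μ.Regular]
    (hμ : dirichletWeight μ n₀ < ∞) (hsupp : (0 : ℝ≥0) ∈ μ.support)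
    (a : ℕ → ℂ) (ha : ∀ n < n₀, a n = 0)
    (hσb : abscissaOfBoundedness a = 0) :
    ∃ L : ℝ → ℝ≥0∞,
      (∀ c : ℝ, 0 < c → Tendsto (fun T : ℝ => dirichletMean μ a c T) atTop (𝓝 (L c))) ∧
      Tendsto L (𝓝[>] 0)
        (𝓝 (∑' n : Set.Ici n₀, ENNReal.ofReal (‖a n‖ ^ 2) * dirichletWeight μ n)) := by
  refine ⟨fun c => ∑' n : ℕ,
    ENNReal.ofReal (‖a n‖ ^ 2 * (n : ℝ) ^ (-2 * c)) * dirichletWeight μ n, fun c hc => ?_, ?_⟩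
  · obtain ⟨ρ, hρ, hb⟩ := exists_dirichletBoundedOn_lt hσb hc
    exact tendsto_dirichletMean hn₀ hμ ha hb hρ
  · have h1 : ∑' n : Set.Ici n₀, ENNReal.ofReal (‖a n‖ ^ 2) * dirichletWeight μ n
        = ∑' n : ℕ, ENNReal.ofReal (‖a n‖ ^ 2) * dirichletWeight μ n := by
      refine tsum_subtype_eq_of_support_subset
        (f := fun n : ℕ => ENNReal.ofReal (‖a n‖ ^ 2) * dirichletWeight μ n) fun n hn => ?_
      by_contra h
      exact hn (by simp [ha n (not_le.1 h)])
    rw [h1]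
    refine tendsto_tsum_rpow_mul (fun n => by positivity) (by simp [ha 0 hn₀]) fun n hn => ?_
    have hle : n₀ ≤ n := not_lt.1 fun h => hn (by simp [ha n h])
    exact ((dirichletWeight_antitone μ hn₀ hle).trans_lt hμ).ne
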